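/- Let $p$ be an odd prime. For $n\ge 0$ put $\zeta_{p^{n+1}}=e^{2\pi i/p^{n+1}}$ and $K_n=\mathbb{Q}(\zeta_{p^{n+1}})\subset\mathbb{C}$, let $\omega_n=(\zeta_{p^{n+1}}-1)$ be the unique prime of $K_n$ above $p$, and let $k_n=(K_n)_{\omega_n}$ be the completion of $K_n$ at $\omega_n$. Thus $k_0=K_{\omega_0}$ with $K=K_0=\mathbb{Q}(\zeta_p)$, and $k_0\subset k_n$ via the continuous extension of the inclusion $K_0\subset K_n$. Complex conjugation on $K_0$ extends by continuity to an automorphism $x\mapsto\bar x$ of $k_0$; an element $x\in k_0$ is called real if $\bar x=x$. A finite extension of local fields is called ramified if its ramification index is greater than $1$. Let $\gamma\in k_0$ be real and suppose that $k_0(\gamma^{1/p})/k_0$ is ramified. Then $k_n(\gamma^{1/p})/k_n$ is ramified for every $n\ge 0$; in particular $k_2(\gamma^{1/p})/k_2$ is ramified. -/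

import Mathlib

open NumberField IsDedekindDomain

noncomputable section

namespace CyclotomicTower

section Completion

variable {F E : Type*} [Field F] [NumberField F] [Field E] [NumberField E]

/-- Let `f : F → E` be an embedding of number fields and let the prime `w` of `E` lie above the
prime `v` of `F` with respect to `f`. This is the extension of `f` by continuity to the completions
`F_v → E_w`. -/
def completionMap (f : F →+* E) (v : HeightOneSpectrum (𝓞 F)) (w : HeightOneSpectrum (𝓞 E))
    (h : v.asIdeal = w.asIdeal.comap (RingOfIntegers.mapRingHom f)) :
    v.adicCompletion F →+* w.adicCompletion E :=
  letI : Algebra F E := f.toAlgebra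
  haveI : w.asIdeal.LiesOver v.asIdeal := ⟨h⟩
  ((HeightOneSpectrum.adicCompletion.equiv E w).symm.toRingHom.comp
    (UniformSpace.Completion.mapRingHom
      (algebraMap (WithVal (v.valuation F)) (WithVal (w.valuation E)))
      (HeightOneSpectrum.uniformContinuous_algebraMap_liesOver F E v w).continuous)).comp
    (HeightOneSpectrum.adicCompletion.equiv F v).toRingHom

/-- The map on completions extends the embedding of number fields. -/
theorem completionMap_algebraMap (f : F →+* E) (v : HeightOneSpectrum (𝓞 F))
    (w : HeightOneSpectrum (𝓞 E))
    (h : v.asIdeal = w.asIdeal.comap (RingOfIntegers.mapRingHom f)) (x : F) :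
    completionMap f v w h (algebraMap F (v.adicCompletion F) x) =
      algebraMap E (w.adicCompletion E) (f x) := by
  let : Algebra F E := f.toAlgebra
  have : w.asIdeal.LiesOver v.asIdeal := ⟨h⟩
  apply HeightOneSpectrum.adicCompletion.ext
  exact UniformSpace.Completion.mapRingHom_coe
    (HeightOneSpectrum.uniformContinuous_algebraMap_liesOver F E v w).continuous
    (WithVal.toVal _ x)

/-- The map on completions is continuous. -/
theorem continuous_completionMap (f : F →+* E) (v : HeightOneSpectrum (𝓞 F))
    (w : HeightOneSpectrum (𝓞 E))
    (h : v.asIdeal = w.asIdeal.comap (RingOfIntegers.mapRingHom f)) :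
    Continuous (completionMap f v w h) := by
  let : Algebra F E := f.toAlgebra
  have : w.asIdeal.LiesOver v.asIdeal := ⟨h⟩
  exact (HeightOneSpectrum.adicCompletion.continuous_ofCompletion E w).comp
    (UniformSpace.Completion.continuous_map.comp
      (HeightOneSpectrum.adicCompletion.continuous_toCompletion F v))

end Completion

section Ramification

/-- `k(x^{1/p})`: the field generated over `k` by the `p`-th roots of `x` in an algebraic closure.
If `k` contains the `p`-th roots of unity, it is generated by any single `p`-th root of `x`. -/
def rootExtension (p : ℕ) {k : Type*} [Field k] (x : k) :
    IntermediateField k (AlgebraicClosure k) :=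
  IntermediateField.adjoin k {a | a ^ p = algebraMap k (AlgebraicClosure k) x}

/-- Let `O` be the valuation ring of a local field `k`, and `L` a finite extension of `k`. Then
`L / k` is ramified if the ramification index `e(P / 𝔪)` is greater than `1`, where `𝔪` is the
maximal ideal of `O` and `P` is the prime above it in the ring of integers of `L`. -/
def IsRamified (O L : Type*) [CommRing O] [IsLocalRing O] [Field L] [Algebra O L] : Prop :=
  ∃ P : Ideal (integralClosure O L),
    P.IsPrime ∧ P.LiesOver (IsLocalRing.maximalIdeal O) ∧ 1 < P.ramificationIdx O

end Ramification

section Tower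

variable (p n : ℕ)

/-- The cyclotomic field `K_n = ℚ(ζ_{p^{n+1}})`, as a subfield of `ℂ`. -/
def K : IntermediateField ℚ ℂ :=
  IntermediateField.adjoin ℚ {z | z ^ p ^ (n + 1) = 1}

theorem K_zero_le : K p 0 ≤ K p n := by
  apply IntermediateField.adjoin.mono
  intro z hz
  rw [Set.mem_ofPred_eq] at hz ⊢
  rw [pow_succ', pow_mul]
  simp only [zero_add, pow_one] at hz
  rw [hz, one_pow]

theorem conj_mem (z : K p n) : starRingEnd ℂ z ∈ K p n := by
  have h : K p n ≤ (K p n).comap (Complex.conjAe.toAlgHom.restrictScalars ℚ) := by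
    refine IntermediateField.adjoin_le_iff.mpr fun z hz => ?_
    refine IntermediateField.subset_adjoin ℚ _ ?_
    rw [Set.mem_ofPred_eq] at hz ⊢
    rw [← map_pow, hz, map_one]
  exact h z.2

/-- Complex conjugation on `K_n`. -/
def conjK : K p n →+* K p n :=
  ((starRingEnd ℂ).comp (K p n).val.toRingHom).codRestrict (K p n) (conj_mem p n)

variable [hp : Fact p.Prime]

instance : IsCyclotomicExtension {p ^ (n + 1)} ℚ (K p n) := by
  have : NeZero (p ^ (n + 1)) := ⟨pow_ne_zero _ hp.out.ne_zero⟩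
  have hζ := Complex.isPrimitiveRoot_exp (p ^ (n + 1)) (NeZero.ne _)
  have e : K p n = IntermediateField.adjoin ℚ {Complex.exp (2 * Real.pi * Complex.I /
      ((p ^ (n + 1) : ℕ) : ℂ))} := by
    apply le_antisymm
    · refine IntermediateField.adjoin_le_iff.mpr fun z hz => ?_
      obtain ⟨i, -, rfl⟩ := hζ.eq_pow_of_pow_eq_one hz
      exact pow_mem (IntermediateField.mem_adjoin_simple_self ℚ _) i
    · exact IntermediateField.adjoin.mono _ _ _ (Set.singleton_subset_iff.mpr hζ.pow_eq_one)
  have h (S : Subalgebra ℚ ℂ) (hS : S = Algebra.adjoin ℚ {Complex.exp (2 * Real.pi * Complex.I /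
      ((p ^ (n + 1) : ℕ) : ℂ))}) : IsCyclotomicExtension {p ^ (n + 1)} ℚ S := by
    rw [hS]
    exact hζ.adjoin_isCyclotomicExtension ℚ
  have h' := h (K p n).toSubalgebra (by
    rw [e, IntermediateField.adjoin_simple_toSubalgebra_of_isAlgebraic
      ((hζ.isIntegral (NeZero.pos _)).tower_top (A := ℚ)).isAlgebraic])
  rw [Subsingleton.elim (DivisionRing.toRatAlgebra : Algebra ℚ (K p n)) (K p n).algebra']
  exact h'

instance : NumberField (K p n) :=
  IsCyclotomicExtension.numberField {p ^ (n + 1)} ℚ (K p n)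

/-- The primitive `p^{n+1}`-th root of unity `exp(2πi / p^{n+1})`, as an element of `K_n`. -/
def zeta : K p n :=
  ⟨Complex.exp (2 * Real.pi * Complex.I / ((p ^ (n + 1) : ℕ) : ℂ)),
    IntermediateField.subset_adjoin ℚ _
      (Complex.isPrimitiveRoot_exp (p ^ (n + 1)) (pow_ne_zero _ hp.out.ne_zero)).pow_eq_one⟩

theorem zeta_spec : IsPrimitiveRoot (zeta p n) (p ^ (n + 1)) :=
  IsPrimitiveRoot.coe_submonoidClass_iff.mp
    (Complex.isPrimitiveRoot_exp (p ^ (n + 1)) (pow_ne_zero _ hp.out.ne_zero))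

/-- The unique prime `ω_n = (ζ_{p^{n+1}} - 1)` of `K_n` above `p`. -/
def omega : HeightOneSpectrum (𝓞 (K p n)) where
  asIdeal := Ideal.span {(zeta_spec p n).toInteger - 1}
  isPrime := IsCyclotomicExtension.Rat.isPrime_span_zeta_sub_one p n (zeta_spec p n)
  ne_bot := IsCyclotomicExtension.Rat.span_zeta_sub_one_ne_bot p n (zeta_spec p n)

/-- Above `p` there is no other prime than `ω_n`. -/
theorem eq_omega (v : HeightOneSpectrum (𝓞 (K p n))) (hv : (p : 𝓞 (K p n)) ∈ v.asIdeal) :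
    v = omega p n := by
  have : v.asIdeal.LiesOver (Ideal.span {(p : ℤ)}) := by
    constructor
    have hmax : (Ideal.span {(p : ℤ)}).IsMaximal :=
      PrincipalIdealRing.isMaximal_of_irreducible (Nat.prime_iff_prime_int.mp hp.out).irreducible
    refine hmax.eq_of_le (Ideal.IsPrime.under ℤ v.asIdeal).ne_top ?_
    rw [Ideal.span_le, Set.singleton_subset_iff]
    simpa [Ideal.mem_comap] using hv
  exact HeightOneSpectrum.ext
    (IsCyclotomicExtension.Rat.eq_span_zeta_sub_one_of_liesOver p n _ (zeta_spec p n) v.asIdeal)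

theorem p_mem_omega : (p : 𝓞 (K p n)) ∈ (omega p n).asIdeal :=
  IsCyclotomicExtension.Rat.p_mem_span_zeta_sub_one p n (zeta_spec p n)

/-- `ω_n` lies above `ω_m` with respect to every embedding `K_m → K_n`. -/
theorem omega_eq_comap (m n : ℕ) (f : K p m →+* K p n) :
    (omega p m).asIdeal = (omega p n).asIdeal.comap (RingOfIntegers.mapRingHom f) := by
  have hmem : (p : 𝓞 (K p m)) ∈ (omega p n).asIdeal.comap (RingOfIntegers.mapRingHom f) := by
    rw [Ideal.mem_comap, map_natCast]
    exact p_mem_omega p n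
  have hprime : ((omega p n).asIdeal.comap (RingOfIntegers.mapRingHom f)).IsPrime :=
    Ideal.IsPrime.comap _
  have hbot : (omega p n).asIdeal.comap (RingOfIntegers.mapRingHom f) ≠ ⊥ := by
    intro h
    rw [h, Ideal.mem_bot] at hmem
    exact hp.out.ne_zero (by exact_mod_cast hmem)
  exact (congrArg HeightOneSpectrum.asIdeal (eq_omega p m ⟨_, hprime, hbot⟩ hmem)).symm

/-- The local field `k_n`: the completion of `K_n` at `ω_n`. In particular `k_0 = K_{ω_0}`. -/
abbrev k : Type := (omega p n).adicCompletion (K p n)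

/-- The ring of integers of `k_n`. -/
abbrev integers : ValuationSubring (k p n) := (omega p n).adicCompletionIntegers (K p n)

/-- The embedding `k_0 → k_n`, the extension by continuity of the inclusion `K_0 ⊆ K_n`. -/
def embedding : k p 0 →+* k p n :=
  completionMap (IntermediateField.inclusion (K_zero_le p n)).toRingHom (omega p 0) (omega p n)
    (omega_eq_comap p 0 n _)

/-- Complex conjugation on `k_n`, extended by continuity from `K_n`. -/
def conj : k p n →+* k p n :=
  completionMap (conjK p n) (omega p n) (omega p n) (omega_eq_comap p n n _)

/-- The extension `k_n(x^{1/p}) / k_n` is ramified. -/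
def RootExtensionRamified (x : k p n) : Prop :=
  IsRamified (integers p n) (rootExtension p x)

end Tower

end CyclotomicTower

end

open NumberField IsDedekindDomain

noncomputable section

namespace CyclotomicTower

/-! ### Completions of number fields: residue field and integral closure. -/

section LocalField
variable {F : Type*} [Field F] [NumberField F] (v : HeightOneSpectrum (𝓞 F))

/-! Complex conjugation inverts the `p`-th roots of unity, and this is played off against a real `γ`
twice; suppose `k_n(γ^{1/p})/k_n` is unramified.

First, `γ` is then a `p`-th power in `k_n`. Since `γ` is real, conjugation extends to an
automorphism `T` of `k_n(γ^{1/p})`. Any `σ` in the Galois group multiplies a root of `γ` by some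
`ζ^i`, and `T` inverts `ζ`, so `σ T σ = T`. On the finite residue field, however, all endomorphisms
commute, so `σ²` acts trivially there. It thus lies in the inertia group, which is trivial, and as
`p` is odd `σ` fixes the roots (`sq_eq_one_of_not_isRamified`, `exists_pow_eq_of_not_isRamified`).

Second, this descends to `k_0`. If `b^p = γ` in `k_n`, an automorphism over `k_0` multiplies `b` by
a power of `ζ` and its conjugate by the inverse power, so `b * conj b` lies in `k_0` and its `p`-th
power is `γ²` (`exists_pow_eq_sq`). As `p` is odd, `γ` is a `p`-th power in `k_0`, so `k_0(γ^{1/p})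
= k_0` is not ramified. -/

theorem mem_integers_iff_norm (x : v.adicCompletion F) :
    x ∈ v.adicCompletionIntegers F ↔ ‖x‖ ≤ 1 := by
  rw [HeightOneSpectrum.mem_adicCompletionIntegers, Valued.toNormedField.norm_le_one_iff]

theorem mem_maximalIdeal_iff_norm (x : v.adicCompletionIntegers F) :
    x ∈ IsLocalRing.maximalIdeal (v.adicCompletionIntegers F) ↔ ‖(x : v.adicCompletion F)‖ < 1 := by
  rw [Valued.toNormedField.norm_lt_one_iff]
  exact Valuation.mem_maximalIdeal_iff ..

instance : NontriviallyNormedField (v.adicCompletion F) where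
  non_trivial := by
    obtain ⟨x, hx⟩ := HeightOneSpectrum.valuedAdicCompletion_surjective F v (WithZero.exp 1)
    refine ⟨x, ?_⟩
    rw [Valued.toNormedField.one_lt_norm_iff, hx, ← WithZero.exp_zero, WithZero.exp_lt_exp]
    exact one_pos

theorem exists_integer_sub_mem_maximalIdeal (x : v.adicCompletionIntegers F) :
    ∃ r : 𝓞 F, x - algebraMap (𝓞 F) (v.adicCompletionIntegers F) r ∈
      IsLocalRing.maximalIdeal (v.adicCompletionIntegers F) := by
  obtain ⟨y, hy⟩ := Metric.denseRange_iff.mp (HeightOneSpectrum.denseRange_algebraMap F v)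
    (x : v.adicCompletion F) 1 one_pos
  rw [dist_eq_norm] at hy
  have hy1 : ‖algebraMap F (v.adicCompletion F) y‖ ≤ 1 := by
    have h := IsUltrametricDist.norm_add_le_max (x : v.adicCompletion F)
      (-(x - algebraMap F (v.adicCompletion F) y))
    rw [← sub_eq_add_neg, sub_sub_cancel, norm_neg] at h
    exact h.trans (max_le ((mem_integers_iff_norm v _).mp x.2) hy.le)
  have hy2 : v.valuation F y ≤ 1 := by
    rw [Valued.toNormedField.norm_le_one_iff] at hy1
    rwa [← HeightOneSpectrum.valuedAdicCompletion_eq_valuation' v y]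
  obtain ⟨r, hr⟩ := v.exists_valuation_sub_lt_of_integer hy2 1
  refine ⟨r, (mem_maximalIdeal_iff_norm v _).mpr ?_⟩
  have hr' : ‖algebraMap F (v.adicCompletion F) (algebraMap (𝓞 F) F r - y)‖ < 1 := by
    rw [Valued.toNormedField.norm_lt_one_iff]
    exact (HeightOneSpectrum.valuedAdicCompletion_eq_valuation' v _).trans_lt hr
  rw [map_sub] at hr'
  have h := IsUltrametricDist.norm_add_le_max (x - algebraMap F (v.adicCompletion F) y)
    (-(algebraMap F (v.adicCompletion F) (algebraMap (𝓞 F) F r) - algebraMap F _ y))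
  rw [← sub_eq_add_neg, sub_sub_sub_cancel_right, norm_neg] at h
  exact h.trans_lt (max_lt hy hr')

/-- By density of `F`, the residue field is a quotient of the finite ring `𝓞 F ⧸ v.asIdeal`. -/
instance : Finite (IsLocalRing.ResidueField (v.adicCompletionIntegers F)) := by
  have : Finite (𝓞 F ⧸ v.asIdeal) := Ideal.finiteQuotientOfFreeOfNeBot _ v.ne_bot
  have h (r : 𝓞 F) (hr : r ∈ v.asIdeal) :
      ((IsLocalRing.residue (v.adicCompletionIntegers F)).comp
        (algebraMap (𝓞 F) (v.adicCompletionIntegers F))) r = 0 := by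
    rw [RingHom.comp_apply, IsLocalRing.residue_eq_zero_iff, mem_maximalIdeal_iff_norm]
    exact (FinitePlace.norm_lt_one_iff_mem F v r).mpr hr
  refine Finite.of_surjective (Ideal.Quotient.lift _ _ h) fun x => ?_
  obtain ⟨x, rfl⟩ := IsLocalRing.residue_surjective x
  obtain ⟨r, hr⟩ := exists_integer_sub_mem_maximalIdeal v x
  refine ⟨Ideal.Quotient.mk _ r, ?_⟩
  rw [Ideal.Quotient.lift_mk, RingHom.comp_apply, eq_comm, ← sub_eq_zero, ← map_sub,
    IsLocalRing.residue_eq_zero_iff]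
  exact hr

section Extension
variable {E : Type*} [Field E] [Algebra (v.adicCompletion F) E]
  [Algebra.IsAlgebraic (v.adicCompletion F) E] [Algebra (v.adicCompletionIntegers F) E]
  [IsScalarTower (v.adicCompletionIntegers F) (v.adicCompletion F) E]

/-- The spectral norm is at most `1` exactly when the minimal polynomial has integral coefficients.
This and the multiplicativity of the norm over a complete field make the integral closure local. -/
theorem isIntegral_iff_spectralNorm_le_one (x : E) :
    IsIntegral (v.adicCompletionIntegers F) x ↔ spectralNorm (v.adicCompletion F) E x ≤ 1 := by
  have hx : IsIntegral (v.adicCompletion F) x := Algebra.IsIntegral.isIntegral x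
  rw [spectralNorm, spectralValue_le_one_iff (minpoly.monic hx)]
  simp_rw [← mem_integers_iff_norm]
  constructor
  · intro h n
    rw [minpoly.isIntegrallyClosed_eq_field_fractions' (v.adicCompletion F) h, Polynomial.coeff_map]
    exact ((minpoly (v.adicCompletionIntegers F) x).coeff n).2
  · intro h
    have hl : minpoly (v.adicCompletion F) x ∈
        Polynomial.lifts (algebraMap (v.adicCompletionIntegers F) (v.adicCompletion F)) := by
      rw [Polynomial.lifts_iff_coeff_lifts]
      exact fun n => ⟨⟨_, h n⟩, rfl⟩
    obtain ⟨q, hq, -, hm⟩ := Polynomial.lifts_and_natDegree_eq_and_monic hl (minpoly.monic hx)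
    refine ⟨q, hm, ?_⟩
    rw [← Polynomial.aeval_def, ← Polynomial.aeval_map_algebraMap (v.adicCompletion F), hq,
      minpoly.aeval]

theorem isUnit_integralClosure_iff (x : integralClosure (v.adicCompletionIntegers F) E) :
    IsUnit x ↔ spectralNorm (v.adicCompletion F) E x = 1 := by
  have h1 := (isIntegral_iff_spectralNorm_le_one v (x : E)).mp x.2
  let := spectralNorm.normedField (v.adicCompletion F) E
  have hn (y : E) : ‖y‖ = spectralNorm (v.adicCompletion F) E y := rfl
  rw [← hn] at h1 ⊢
  constructor
  · intro h
    obtain ⟨y, hy⟩ := h.exists_right_inv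
    have hy1 := (isIntegral_iff_spectralNorm_le_one v (y : E)).mp y.2
    rw [← hn] at hy1
    have := congrArg (fun z : integralClosure (v.adicCompletionIntegers F) E => ‖(z : E)‖) hy
    simp only [MulMemClass.coe_mul, OneMemClass.coe_one, norm_mul, norm_one] at this
    nlinarith [norm_nonneg (x : E), norm_nonneg (y : E)]
  · intro h
    have hx0 : (x : E) ≠ 0 := by
      rw [← norm_ne_zero_iff, h]; exact one_ne_zero
    refine IsUnit.of_mul_eq_one ⟨(x : E)⁻¹, (isIntegral_iff_spectralNorm_le_one v _).mpr ?_⟩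
      (Subtype.ext (mul_inv_cancel₀ hx0))
    rw [← hn, norm_inv, h, inv_one]

theorem isLocalRing_integralClosure :
    IsLocalRing (integralClosure (v.adicCompletionIntegers F) E) := by
  refine IsLocalRing.of_nonunits_add fun x y hx hy => ?_
  rw [mem_nonunits_iff, isUnit_integralClosure_iff] at *
  have h1 := (isIntegral_iff_spectralNorm_le_one v (x : E)).mp x.2
  have h2 := (isIntegral_iff_spectralNorm_le_one v (y : E)).mp y.2
  refine ((isNonarchimedean_spectralNorm (K := (v.adicCompletion F)) (L := E) (x : E) y).trans_lt
    (max_lt (lt_of_le_of_ne h1 hx) (lt_of_le_of_ne h2 hy))).ne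

end Extension

end LocalField

/-! ### Ramification as nontriviality of the inertia group. -/

section Inertia
variable (O k E : Type*) [CommRing O] [IsDomain O] [IsDiscreteValuationRing O] [Field k]
  [Algebra O k] [IsFractionRing O k] [Field E] [Algebra k E] [Algebra O E] [IsScalarTower O k E]
  [IsGalois k E] [IsLocalRing (integralClosure O E)]

include k in
theorem liesOver_maximalIdeal_iff (P : Ideal (integralClosure O E)) [P.IsPrime] :
    P.LiesOver (IsLocalRing.maximalIdeal O) ↔ P = IsLocalRing.maximalIdeal _ := by
  have key (P : Ideal (integralClosure O E)) [P.IsPrime]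
      (h : P.LiesOver (IsLocalRing.maximalIdeal O)) : P = IsLocalRing.maximalIdeal _ := by
    refine IsLocalRing.eq_maximalIdeal
      (Ideal.isMaximal_of_isIntegral_of_isMaximal_comap (R := O) P ?_)
    have h2 : IsLocalRing.maximalIdeal O = P.comap (algebraMap O (integralClosure O E)) := h.over
    rw [← h2]
    infer_instance
  refine ⟨fun h => key P h, ?_⟩
  rintro rfl
  have : FaithfulSMul O k := inferInstance
  have : FaithfulSMul O E := .trans O k E
  obtain ⟨Q, hQ, hQO⟩ :=
    (inferInstance : Nonempty ((IsLocalRing.maximalIdeal O).primesOver (integralClosure O E)))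
  rwa [← key Q hQO]

variable [FiniteDimensional k E] [Finite (IsLocalRing.ResidueField O)]

/-- The order of the inertia group is the ramification index, and the maximal ideal is the only
prime to consider. -/
theorem isRamified_iff_inertia_ne_bot : IsRamified O E ↔
    (IsLocalRing.maximalIdeal (integralClosure O E)).inertia Gal(E/k) ≠ ⊥ := by
  set B := integralClosure O E
  have : Module.Finite O B := IsIntegralClosure.finite O k E B
  have : IsFractionRing B E := IsIntegralClosure.isFractionRing_of_finite_extension O k E B
  have : IsGaloisGroup Gal(E/k) O B := IsGaloisGroup.of_isFractionRing _ _ _ k E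
  have hlo := (liesOver_maximalIdeal_iff O k E (IsLocalRing.maximalIdeal B)).mpr rfl
  have : Module.IsTorsionFree O E := .trans_faithfulSMul O k E
  have : Module.Free O B := Module.free_of_finite_type_torsion_free'
  have : Finite (O ⧸ IsLocalRing.maximalIdeal O) :=
    inferInstanceAs (Finite (IsLocalRing.ResidueField O))
  have hcard := Ideal.card_inertia_eq_ramificationIdxIn (G := Gal(E/k))
    (IsLocalRing.maximalIdeal O) (IsLocalRing.maximalIdeal B)
  rw [Ideal.ramificationIdxIn_eq_ramificationIdx (IsLocalRing.maximalIdeal O)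
    (IsLocalRing.maximalIdeal B) Gal(E/k)] at hcard
  rw [← Subgroup.one_lt_card_iff_ne_bot, hcard]
  constructor
  · rintro ⟨P, hP, hPO, h⟩
    rwa [← (liesOver_maximalIdeal_iff O k E P).mp hPO]
  · exact fun h => ⟨_, inferInstance, hlo, h⟩

include k in
theorem finite_residueField_integralClosure :
    Finite (IsLocalRing.ResidueField (integralClosure O E)) := by
  have : Module.Finite O (integralClosure O E) := IsIntegralClosure.finite O k E _
  have : FaithfulSMul O E := .trans O k E
  have : IsLocalHom (algebraMap O (integralClosure O E)) := inferInstance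
  exact IsLocalRing.ResidueField.finite_of_finite (R := O) inferInstance

end Inertia

/-- The unit group is cyclic, so each endomorphism acts on it as a power map, and power maps
commute. -/
theorem ringHom_commute_of_finite {k : Type*} [Field k] [Finite k] (f g : k →+* k) (x : k) :
    f (g x) = g (f x) := by
  rcases eq_or_ne x 0 with rfl | hx
  · simp
  obtain ⟨a, ha⟩ := MonoidHom.map_cyclic (Units.map (f : k →* k))
  obtain ⟨b, hb⟩ := MonoidHom.map_cyclic (Units.map (g : k →* k))
  have := congrArg Units.val ((zpow_mul (Units.mk0 x hx) a b).symm.trans (zpow_mul' _ a b))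
  rw [← ha, ← hb, ← ha, ← hb] at this
  exact this.symm

/-! ### Commutation in the residue field of an unramified extension. -/

section Conjugation
variable (O k : Type*) {E : Type*} [CommRing O] [IsDomain O] [IsDiscreteValuationRing O] [Field k]
  [Algebra O k] [IsFractionRing O k] [Field E] [Algebra k E] [Algebra O E] [IsScalarTower O k E]
  [FiniteDimensional k E] [IsGalois k E] [Finite (IsLocalRing.ResidueField O)]
  [IsLocalRing (integralClosure O E)]

/-- Restriction to the integral closure of an automorphism preserving integrality. -/
def integralClosureEquiv {O E : Type*} [CommRing O] [Field E] [Algebra O E] (τ : E ≃+* E)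
    (hτ : ∀ x, IsIntegral O (τ x) ↔ IsIntegral O x) :
    integralClosure O E ≃+* integralClosure O E where
  toFun x := ⟨τ x, (hτ x).mpr x.2⟩
  invFun x := ⟨τ.symm x, (hτ _).mp (by rw [τ.apply_symm_apply]; exact x.2)⟩
  left_inv x := Subtype.ext (τ.symm_apply_apply x)
  right_inv x := Subtype.ext (τ.apply_symm_apply x)
  map_mul' x y := Subtype.ext (map_mul τ (x : E) y)
  map_add' x y := Subtype.ext (map_add τ (x : E) y)

-- `τ` need not be `k`-linear: it only has to induce a map on the residue field. There it commutes
-- with `σ` and cancels from `σ τ σ = τ`, which puts `σ²` in the trivial inertia group.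
include O in
theorem sq_eq_one_of_not_isRamified (hE : ¬ IsRamified O E) (τ : E ≃+* E)
    (hτ : ∀ x, IsIntegral O (τ x) ↔ IsIntegral O x) (σ : Gal(E/k))
    (h : ∀ y, σ (τ (σ y)) = τ y) : σ ^ 2 = 1 := by
  rw [isRamified_iff_inertia_ne_bot O k E, not_not] at hE
  have := finite_residueField_integralClosure O k E
  have hσ (x : E) : IsIntegral O (σ x) ↔ IsIntegral O x :=
    isIntegral_algEquiv (σ.restrictScalars O)
  let f := IsLocalRing.ResidueField.map
    (integralClosureEquiv (σ : E ≃+* E) hσ : integralClosure O E →+* integralClosure O E)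
  let g := IsLocalRing.ResidueField.map
    (integralClosureEquiv τ hτ : integralClosure O E →+* integralClosure O E)
  rw [← Subgroup.mem_bot, ← hE, AddSubgroup.mem_inertia]
  intro b
  rw [Submodule.mem_toAddSubgroup, ← IsLocalRing.residue_eq_zero_iff, map_sub, sub_eq_zero]
  have h1 : f (g (f (IsLocalRing.residue _ b))) = g (IsLocalRing.residue _ b) :=
    congrArg (IsLocalRing.residue _) (Subtype.ext (h b) :
      integralClosureEquiv (σ : E ≃+* E) hσ (integralClosureEquiv τ hτ
        (integralClosureEquiv (σ : E ≃+* E) hσ b)) = integralClosureEquiv τ hτ b)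
  rw [ringHom_commute_of_finite f g] at h1
  exact g.injective h1

end Conjugation

/-! ### The field generated by the `p`-th roots of an element. -/

section RootExtension

variable {p : ℕ} {k : Type*} [Field k]

theorem exists_eq_zeta_pow_mul [NeZero p] {ζ : k} (hζ : IsPrimitiveRoot ζ p)
    {E : Type*} [Field E] [Algebra k E] {a b : E} (h : b ^ p = a ^ p) :
    ∃ i : ℕ, b = algebraMap k E (ζ ^ i) * a := by
  rcases eq_or_ne a 0 with rfl | ha
  · rw [zero_pow (NeZero.ne p)] at h
    exact ⟨0, by rw [eq_zero_of_pow_eq_zero h, mul_zero]⟩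
  · obtain ⟨i, -, hi⟩ := (hζ.map_of_injective (algebraMap k E).injective).eq_pow_of_pow_eq_one
      (ξ := b / a) (by rw [div_pow, h, div_self (pow_ne_zero _ ha)])
    exact ⟨i, by rw [map_pow, hi, div_mul_cancel₀ _ ha]⟩

theorem isSplittingField_rootExtension (hp : p ≠ 0) (x : k) :
    (Polynomial.X ^ p - Polynomial.C x).IsSplittingField k (rootExtension p x) := by
  have h : {a | a ^ p = algebraMap k (AlgebraicClosure k) x} =
      (Polynomial.X ^ p - Polynomial.C x).rootSet (AlgebraicClosure k) := by
    ext a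
    rw [Polynomial.mem_rootSet_of_ne (Polynomial.X_pow_sub_C_ne_zero (Nat.pos_of_ne_zero hp) x)]
    simp [sub_eq_zero]
  rw [rootExtension, h]
  exact IntermediateField.adjoin_rootSet_isSplittingField (IsAlgClosed.splits _)

theorem map_mem_rootExtension {x : k} (T : AlgebraicClosure k →+* AlgebraicClosure k) (τ : k →+* k)
    (hT : ∀ c, T (algebraMap k _ c) = algebraMap k _ (τ c)) (hx : τ x = x)
    {y : AlgebraicClosure k} (hy : y ∈ rootExtension p x) : T y ∈ rootExtension p x := by
  induction hy using IntermediateField.adjoin_induction with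
  | mem a ha =>
    refine IntermediateField.subset_adjoin _ _ ?_
    rw [Set.mem_ofPred_eq] at ha ⊢
    rw [← map_pow, ha, hT, hx]
  | algebraMap c => rw [hT]; exact IntermediateField.algebraMap_mem _ _
  | add a b _ _ ha hb => rw [map_add]; exact add_mem ha hb
  | mul a b _ _ ha hb => rw [map_mul]; exact mul_mem ha hb
  | inv a _ ha => rw [map_inv₀]; exact inv_mem ha

theorem exists_rootExtension_equiv {x : k} (τ : k ≃+* k) (hx : τ x = x) :
    ∃ T : rootExtension p x ≃+* rootExtension p x,
      ∀ c, T (algebraMap k _ c) = algebraMap k _ (τ c) := by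
  let S : AlgebraicClosure k ≃+* AlgebraicClosure k :=
    IsAlgClosure.equivOfEquiv (AlgebraicClosure k) (AlgebraicClosure k) τ
  have hS (c : k) : S (algebraMap k _ c) = algebraMap k _ (τ c) :=
    IsAlgClosure.equivOfEquiv_algebraMap ..
  have hS' (c : k) : S.symm (algebraMap k _ c) = algebraMap k _ (τ.symm c) := by
    rw [RingEquiv.symm_apply_eq, hS, τ.apply_symm_apply]
  have hx' : τ.symm x = x := by rw [RingEquiv.symm_apply_eq, hx]
  refine ⟨
    { toFun := fun y => ⟨S y, map_mem_rootExtension (S : _ →+* _) (τ : k →+* k) hS hx y.2⟩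
      invFun := fun y => ⟨S.symm y,
        map_mem_rootExtension (S.symm : _ →+* _) (τ.symm : k →+* k) hS' hx' y.2⟩
      left_inv := fun y => Subtype.ext (S.symm_apply_apply _)
      right_inv := fun y => Subtype.ext (S.apply_symm_apply _)
      map_mul' := fun y z => Subtype.ext (map_mul S _ _)
      map_add' := fun y z => Subtype.ext (map_add S _ _) }, fun c => Subtype.ext (hS c)⟩

theorem rootExtension_hom_ext {x : k} {L : Type*} [Field L] (f g : rootExtension p x →+* L)
    (hk : ∀ c, f (algebraMap k _ c) = g (algebraMap k _ c))
    (hr : ∀ a : rootExtension p x, a ^ p = algebraMap k _ x → f a = g a) : f = g := by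
  ext ⟨y, hy⟩
  induction hy using IntermediateField.adjoin_induction with
  | mem a ha => exact hr _ (Subtype.ext ha)
  | algebraMap c => exact hk c
  | add a b ha' hb' ha hb =>
    exact (map_add f ⟨a, ha'⟩ ⟨b, hb'⟩).trans ((congrArg₂ _ ha hb).trans (map_add g _ _).symm)
  | mul a b ha' hb' ha hb =>
    exact (map_mul f ⟨a, ha'⟩ ⟨b, hb'⟩).trans ((congrArg₂ _ ha hb).trans (map_mul g _ _).symm)
  | inv a ha' ha =>
    exact (map_inv₀ f ⟨a, ha'⟩).trans ((congrArg _ ha).trans (map_inv₀ g _).symm)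

end RootExtension

/-! ### Elements fixed by an automorphism that inverts `ζ`. -/

section Real

variable {p : ℕ} [hp : Fact p.Prime] {O k : Type*} [CommRing O] [IsDomain O]
  [IsDiscreteValuationRing O] [Field k] [CharZero k] [Algebra O k] [IsFractionRing O k]
  [Finite (IsLocalRing.ResidueField O)]

theorem exists_pow_eq_of_not_isRamified (hodd : Odd p) {ζ : k} (hζ : IsPrimitiveRoot ζ p)
    (τ : k ≃+* k) (τO : O ≃+* O) (hτO : ∀ c, τ (algebraMap O k c) = algebraMap O k (τO c))
    (hτζ : τ ζ = ζ⁻¹) {x : k} (hx : τ x = x) [IsLocalRing (integralClosure O (rootExtension p x))]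
    (h : ¬ IsRamified O (rootExtension p x)) : ∃ b : k, b ^ p = x := by
  rcases eq_or_ne x 0 with rfl | hx0
  · exact ⟨0, zero_pow hp.out.ne_zero⟩
  have hspl := isSplittingField_rootExtension hp.out.ne_zero x
  have : FiniteDimensional k (rootExtension p x) := hspl.finiteDimensional
  have : Normal k (rootExtension p x) := .of_isSplittingField (Polynomial.X ^ p - Polynomial.C x)
  have : IsGalois k (rootExtension p x) := ⟨⟩
  obtain ⟨T, hT⟩ := exists_rootExtension_equiv (p := p) τ hx
  have hTc (c : O) : T (algebraMap O _ c) = algebraMap O _ (τO c) := by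
    rw [IsScalarTower.algebraMap_apply O k, hT, hτO, ← IsScalarTower.algebraMap_apply]
  have hTO (y) : IsIntegral O (T y) ↔ IsIntegral O y := by
    constructor
    · intro hy
      have := hy.map_of_comp_eq (τO.symm : O →+* O)
        (T.symm : rootExtension p x →+* rootExtension p x) <| RingHom.ext fun c => by
          simp [RingEquiv.eq_symm_apply, hTc]
      simpa using this
    · exact fun hy => hy.map_of_comp_eq (τO : O →+* O)
        (T : rootExtension p x →+* rootExtension p x) (RingHom.ext fun c => (hTc c).symm)
  have hroot (a : rootExtension p x) (ha : a ^ p = algebraMap k _ x)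
      (f : rootExtension p x →+* rootExtension p x)
      (hf : f (algebraMap k _ x) = algebraMap k _ x) :
      ∃ i : ℕ, f a = algebraMap k _ (ζ ^ i) * a :=
    exists_eq_zeta_pow_mul hζ (by rw [← map_pow, ha, hf])
  have hsq (σ : Gal(rootExtension p x/k)) : σ ^ 2 = 1 := by
    refine sq_eq_one_of_not_isRamified O k h T hTO σ fun y => ?_
    refine RingHom.congr_fun (rootExtension_hom_ext
      ((σ : rootExtension p x →+* rootExtension p x).comp
        ((T : rootExtension p x →+* rootExtension p x).comp
        (σ : rootExtension p x →+* rootExtension p x))) (T : rootExtension p x →+* _) ?_ ?_) y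
    · intro c
      simp [hT]
    · intro a ha
      obtain ⟨i, hi⟩ := hroot a ha (σ : rootExtension p x →+* rootExtension p x) (σ.commutes x)
      obtain ⟨j, hj⟩ := hroot a ha (T : rootExtension p x →+* rootExtension p x)
        ((hT x).trans (congrArg _ hx))
      simp only [RingHom.coe_coe, RingHom.comp_apply] at hi hj ⊢
      -- With `σ a = ζ^i a` and `T a = ζ^j a`, one gets `σ T σ a = ζ^{-i} ζ^j ζ^i a = T a`.
      rw [hi, map_mul, hT, hj, map_mul, map_mul, σ.commutes, σ.commutes, hi, map_pow, hτζ]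
      rw [mul_left_comm, mul_comm (algebraMap k _ (ζ⁻¹ ^ i)), mul_right_comm, ← map_mul, ← mul_pow,
        mul_inv_cancel₀ (hζ.ne_zero hp.out.ne_zero), one_pow, map_one, one_mul]
  obtain ⟨a, ha⟩ := IsAlgClosed.exists_pow_nat_eq (algebraMap k (AlgebraicClosure k) x) hp.out.pos
  let a' : rootExtension p x := ⟨a, IntermediateField.subset_adjoin _ _ ha⟩
  have ha' : a' ^ p = algebraMap k _ x := Subtype.ext ha
  have ha0 : a' ≠ 0 := by
    intro h0
    rw [h0, zero_pow hp.out.ne_zero, eq_comm, map_eq_zero] at ha'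
    exact hx0 ha'
  have hfix (σ : Gal(rootExtension p x/k)) : σ a' = a' := by
    obtain ⟨i, hi⟩ := hroot a' ha' (σ : rootExtension p x →+* rootExtension p x) (σ.commutes x)
    rw [RingHom.coe_coe] at hi
    have h2 : (σ ^ 2) a' = a' := by rw [hsq]; rfl
    rw [pow_two, AlgEquiv.mul_apply, hi, map_mul, σ.commutes, hi, ← mul_assoc, mul_eq_right₀ ha0,
      ← map_mul, ← pow_add, map_eq_one_iff _ (algebraMap k _).injective,
      hζ.pow_eq_one_iff_dvd, ← two_mul] at h2
    -- `σ² = 1` gave `ζ^{2i} = 1`, and `p` is odd.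
    have h3 : p ∣ i := (Nat.Coprime.dvd_of_dvd_mul_left (hodd.coprime_two_right) h2)
    rw [hi, (hζ.pow_eq_one_iff_dvd i).mpr h3, map_one, one_mul]
  obtain ⟨b, hb⟩ := (IsGalois.mem_bot_iff_fixed a').mpr hfix
  refine ⟨b, (algebraMap k (rootExtension p x)).injective ?_⟩
  rw [map_pow, ← ha', ← hb]
  rfl

theorem not_isRamified_of_pow {ζ : k} (hζ : IsPrimitiveRoot ζ p) (b : k)
    [IsLocalRing (integralClosure O (rootExtension p (b ^ p)))] :
    ¬ IsRamified O (rootExtension p (b ^ p)) := by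
  have hspl := isSplittingField_rootExtension hp.out.ne_zero (b ^ p)
  have : FiniteDimensional k (rootExtension p (b ^ p)) := hspl.finiteDimensional
  have : Normal k (rootExtension p (b ^ p)) :=
    .of_isSplittingField (Polynomial.X ^ p - Polynomial.C (b ^ p))
  have : IsGalois k (rootExtension p (b ^ p)) := ⟨⟩
  rw [isRamified_iff_inertia_ne_bot O k, not_not, eq_bot_iff]
  intro σ _
  rw [Subgroup.mem_bot]
  have hr := rootExtension_hom_ext (σ : rootExtension p (b ^ p) →+* rootExtension p (b ^ p))
    (RingHom.id _) (fun c => σ.commutes c) fun a ha => by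
      rw [map_pow] at ha
      obtain ⟨i, rfl⟩ := exists_eq_zeta_pow_mul hζ ha
      rw [← map_mul]
      exact σ.commutes _
  ext1 y
  exact RingHom.congr_fun hr y

end Real

-- Norm less than `1` means that the powers tend to `0`, a condition preserved by continuous
-- homomorphisms. Hence conjugation preserves integrality, with no need to show that it is an
-- isometry.
open Filter Topology in
theorem norm_map_lt_one {k L : Type*} [NormedField k] [NormedField L] (f : k →+* L)
    (hf : Continuous f) {x : k} (hx : ‖x‖ < 1) : ‖f x‖ < 1 := by
  have h1 := (hf.tendsto 0).comp (tendsto_pow_atTop_nhds_zero_of_norm_lt_one hx)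
  rw [map_zero] at h1
  refine tendsto_pow_atTop_nhds_zero_iff_norm_lt_one.mp (h1.congr fun m => ?_)
  rw [Function.comp_apply, map_pow]

theorem norm_map_le_one_iff {k : Type*} [NormedField k] (f : k ≃+* k)
    (hf : Continuous f) (hf' : Continuous f.symm) (x : k) : ‖f x‖ ≤ 1 ↔ ‖x‖ ≤ 1 := by
  have key (g : k ≃+* k) (hg : Continuous g) (y : k) (hy : 1 < ‖y‖) : 1 < ‖g y‖ := by
    have h := norm_map_lt_one (g : k →+* k) hg (x := y⁻¹)
      (by rw [norm_inv]; exact inv_lt_one_of_one_lt₀ hy)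
    rw [RingHom.coe_coe, map_inv₀, norm_inv] at h
    have hy0 : y ≠ 0 := norm_pos_iff.mp (one_pos.trans hy)
    exact (inv_lt_one₀ (norm_pos_iff.mpr ((map_ne_zero g).mpr hy0))).mp h
  rw [← not_lt, ← not_lt, not_iff_not]
  refine ⟨fun h => ?_, key f hf x⟩
  simpa using key f.symm hf' _ h

/-! ### Conjugation on the tower `k_n` and descent to `k_0`. -/

section Tower

variable (p n : ℕ) [hp : Fact p.Prime]

instance : CharZero (k p n) :=
  charZero_of_injective_algebraMap (algebraMap (K p n) (k p n)).injective

theorem ringHom_ext_of_continuous {L : Type*} [Field L] [TopologicalSpace L] [T2Space L]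
    {f g : k p n →+* L} (hf : Continuous f) (hg : Continuous g)
    (h : ∀ x : K p n, f (algebraMap _ _ x) = g (algebraMap _ _ x)) : f = g :=
  DFunLike.coe_injective ((HeightOneSpectrum.denseRange_algebraMap (K p n) (omega p n)).equalizer
    hf hg (funext h))

theorem continuous_conj : Continuous (conj p n) := continuous_completionMap ..

theorem continuous_embedding : Continuous (embedding p n) := continuous_completionMap ..

theorem conj_algebraMap (x : K p n) :
    conj p n (algebraMap _ _ x) = algebraMap _ _ (conjK p n x) := completionMap_algebraMap ..

theorem embedding_algebraMap (x : K p 0) : embedding p n (algebraMap _ _ x) =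
    algebraMap _ _ (IntermediateField.inclusion (K_zero_le p n) x) := completionMap_algebraMap ..

theorem conj_comp_conj : (conj p n).comp (conj p n) = RingHom.id _ := by
  refine ringHom_ext_of_continuous p n ((continuous_conj p n).comp (continuous_conj p n))
    continuous_id fun x => ?_
  rw [RingHom.comp_apply, conj_algebraMap, conj_algebraMap]
  exact congrArg (algebraMap (K p n) (k p n))
    (Subtype.ext (Complex.conj_conj (x : ℂ)) : conjK p n (conjK p n x) = x)

theorem conj_embedding (x : k p 0) : conj p n (embedding p n x) = embedding p n (conj p 0 x) := by
  refine RingHom.congr_fun (f := (conj p n).comp (embedding p n))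
    (g := (embedding p n).comp (conj p 0)) (ringHom_ext_of_continuous p 0
      ((continuous_conj p n).comp (continuous_embedding p n))
      ((continuous_embedding p n).comp (continuous_conj p 0)) fun x => ?_) x
  rw [RingHom.comp_apply, RingHom.comp_apply, conj_algebraMap, embedding_algebraMap,
    embedding_algebraMap, conj_algebraMap]
  rfl

/-- Complex conjugation as an automorphism of `k_n`. -/
def conjEquiv : k p n ≃+* k p n :=
  RingEquiv.ofRingHom (conj p n) (conj p n) (conj_comp_conj p n) (conj_comp_conj p n)

theorem conjEquiv_mem_integers_iff (x : k p n) :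
    conjEquiv p n x ∈ integers p n ↔ x ∈ integers p n := by
  rw [mem_integers_iff_norm, mem_integers_iff_norm]
  exact norm_map_le_one_iff (conjEquiv p n) (continuous_conj p n) (continuous_conj p n) x

/-- Complex conjugation on the ring of integers of `k_n`. -/
def conjIntegers : integers p n ≃+* integers p n where
  toFun x := ⟨conjEquiv p n x, (conjEquiv_mem_integers_iff p n _).mpr x.2⟩
  invFun x := ⟨(conjEquiv p n).symm x, (conjEquiv_mem_integers_iff p n _).mp
    (by rw [RingEquiv.apply_symm_apply]; exact x.2)⟩
  left_inv x := Subtype.ext (RingEquiv.symm_apply_apply _ _)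
  right_inv x := Subtype.ext (RingEquiv.apply_symm_apply _ _)
  map_mul' x y := Subtype.ext (map_mul (conjEquiv p n) _ _)
  map_add' x y := Subtype.ext (map_add (conjEquiv p n) _ _)

/-- The image of `ζ_{p^{n+1}}` in `k_n`. -/
def localZeta : k p n := algebraMap _ _ (zeta p n)

theorem localZeta_spec : IsPrimitiveRoot (localZeta p n) (p ^ (n + 1)) :=
  (zeta_spec p n).map_of_injective (algebraMap (K p n) (k p n)).injective

theorem conj_localZeta : conj p n (localZeta p n) = (localZeta p n)⁻¹ := by
  rw [localZeta, conj_algebraMap, ← map_inv₀]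
  congr 1
  refine Subtype.ext (Complex.inv_eq_conj ?_).symm
  exact (IsPrimitiveRoot.coe_submonoidClass_iff.mpr (zeta_spec p n)).norm'_eq_one
    (pow_ne_zero _ hp.out.ne_zero)

theorem isPrimitiveRoot_localZeta_pow : IsPrimitiveRoot (localZeta p n ^ p ^ n) p :=
  (localZeta_spec p n).pow (pow_pos hp.out.pos _) (pow_succ p n)

theorem exists_pow_eq_of_not_rootExtensionRamified (hodd : Odd p) {x : k p n}
    (hx : conj p n x = x) (h : ¬ RootExtensionRamified p n x) : ∃ b : k p n, b ^ p = x := by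
  have : FiniteDimensional (k p n) (rootExtension p x) :=
    (isSplittingField_rootExtension hp.out.ne_zero x).finiteDimensional
  have := isLocalRing_integralClosure (omega p n) (E := rootExtension p x)
  exact exists_pow_eq_of_not_isRamified (O := integers p n) hodd (isPrimitiveRoot_localZeta_pow p n)
    (conjEquiv p n) (conjIntegers p n) (fun c => rfl)
    ((map_pow (conj p n) _ _).trans (by rw [conj_localZeta, inv_pow])) hx h

theorem not_rootExtensionRamified_pow (b : k p n) : ¬ RootExtensionRamified p n (b ^ p) := by
  have : FiniteDimensional (k p n) (rootExtension p (b ^ p)) :=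
    (isSplittingField_rootExtension hp.out.ne_zero _).finiteDimensional
  have := isLocalRing_integralClosure (omega p n) (E := rootExtension p (b ^ p))
  exact not_isRamified_of_pow (isPrimitiveRoot_localZeta_pow p n) b

/-- The left side is finite-dimensional over the complete field `k_0`, hence closed in `k_n`, and it
contains the dense subfield `K_n`. -/
theorem adjoin_localZeta_eq_top : letI := (embedding p n).toAlgebra
    Algebra.adjoin (k p 0) {localZeta p n} = ⊤ := by
  let := (embedding p n).toAlgebra
  have : ContinuousSMul (k p 0) (k p n) :=
    ⟨((continuous_embedding p n).comp continuous_fst).mul continuous_snd⟩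
  have hint : IsIntegral (k p 0) (localZeta p n) :=
    ⟨Polynomial.X ^ p ^ (n + 1) - 1, Polynomial.monic_X_pow_sub_C 1 (pow_ne_zero _ hp.out.ne_zero),
      by simp [(localZeta_spec p n).pow_eq_one]⟩
  let S := Subalgebra.toSubmodule (Algebra.adjoin (k p 0) {localZeta p n})
  have : FiniteDimensional (k p 0) S := Module.Finite.iff_fg.mpr hint.fg_adjoin_singleton
  have hc : IsClosed (S : Set (k p n)) := S.closed_of_finiteDimensional
  have hK (x : K p n) : algebraMap (K p n) (k p n) x ∈ S := by
    have hx : x ∈ Algebra.adjoin ℚ {zeta p n} := by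
      rw [IsCyclotomicExtension.adjoin_primitive_root_eq_top (zeta_spec p n)]
      trivial
    induction hx using Algebra.adjoin_induction with
    | mem y hy =>
      rw [Set.mem_singleton_iff.mp hy]
      exact Algebra.self_mem_adjoin_singleton _ _
    | algebraMap q =>
      rw [eq_ratCast, map_ratCast, ← map_ratCast (algebraMap (k p 0) (k p n))]
      exact Subalgebra.algebraMap_mem _ _
    | add y z _ _ hy hz => rw [map_add]; exact add_mem hy hz
    | mul y z _ _ hy hz =>
      rw [map_mul]; exact (Algebra.adjoin (k p 0) {localZeta p n}).mul_mem hy hz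
  refine Algebra.eq_top_iff.mpr fun x => ?_
  exact hc.closure_subset_iff.mpr (Set.range_subset_iff.mpr hK)
    (HeightOneSpectrum.denseRange_algebraMap (K p n) (omega p n) x)

theorem exists_pow_eq_sq {γ : k p 0} (hγ : conj p 0 γ = γ) {b : k p n}
    (hb : b ^ p = embedding p n γ) : ∃ d : k p 0, d ^ p = γ ^ 2 := by
  let := (embedding p n).toAlgebra
  have htop := adjoin_localZeta_eq_top p n
  have : NeZero (p ^ (n + 1)) := ⟨pow_ne_zero _ hp.out.ne_zero⟩
  have hcyc : IsCyclotomicExtension {p ^ (n + 1)} (k p 0) (k p n) := by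
    rw [IsCyclotomicExtension.iff_singleton]
    refine ⟨⟨_, localZeta_spec p n⟩, fun x => ?_⟩
    refine Algebra.adjoin_mono ?_ (htop ▸ trivial : x ∈ Algebra.adjoin (k p 0) {localZeta p n})
    exact Set.singleton_subset_iff.mpr (localZeta_spec p n).pow_eq_one
  have hgal : IsGalois (k p 0) (k p n) := IsCyclotomicExtension.isGalois {p ^ (n + 1)} _ _
  have hfin : FiniteDimensional (k p 0) (k p n) :=
    IsCyclotomicExtension.finiteDimensional {p ^ (n + 1)} _ _
  -- Conjugation is not `k_0`-linear, but it preserves `k_0` and inverts `localZeta`, whose image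
  -- under `σ` is one of its own powers. Checking on these generators suffices.
  have hcomm (σ : Gal(k p n/k p 0)) (x : k p n) : σ (conj p n x) = conj p n (σ x) := by
    have hx : x ∈ Algebra.adjoin (k p 0) {localZeta p n} := htop ▸ trivial
    induction hx using Algebra.adjoin_induction with
    | mem y hy =>
      rw [Set.mem_singleton_iff.mp hy, conj_localZeta, map_inv₀]
      obtain ⟨i, -, hi⟩ := (localZeta_spec p n).eq_pow_of_pow_eq_one (ξ := σ (localZeta p n))
        (by rw [← map_pow, (localZeta_spec p n).pow_eq_one, map_one])
      rw [← hi, map_pow, conj_localZeta, inv_pow]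
    | algebraMap c =>
      rw [σ.commutes]
      exact (congrArg σ (conj_embedding p n c)).trans
        ((σ.commutes _).trans (conj_embedding p n c).symm)
    | add y z _ _ hy hz => simp only [map_add, hy, hz]
    | mul y z _ _ hy hz => simp only [map_mul, hy, hz]
  have hζ := isPrimitiveRoot_localZeta_pow p 0
  -- `σ` multiplies `b` by `ζ^i` and `conj b` by `ζ^{-i}`, where `ζ` is a `p`-th root of unity
  -- already in `k_0`.
  have hfix (σ : Gal(k p n/k p 0)) : σ (b * conj p n b) = b * conj p n b := by
    obtain ⟨i, hi⟩ := exists_eq_zeta_pow_mul hζ (a := b) (b := σ b)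
      (by rw [← map_pow, hb]; exact σ.commutes γ)
    have h1 : conj p n (algebraMap (k p 0) (k p n) ((localZeta p 0 ^ p ^ 0) ^ i)) =
        algebraMap (k p 0) (k p n) ((localZeta p 0 ^ p ^ 0)⁻¹ ^ i) := by
      refine (conj_embedding p n _).trans ?_
      rw [map_pow (conj p 0), map_pow (conj p 0), conj_localZeta, inv_pow]
      rfl
    rw [map_mul, hcomm, hi, map_mul, h1, mul_mul_mul_comm, ← map_mul, ← mul_pow,
      mul_inv_cancel₀ (hζ.ne_zero hp.out.ne_zero), one_pow, map_one, one_mul]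
  obtain ⟨d, hd⟩ := (IsGalois.mem_bot_iff_fixed _).mpr hfix
  refine ⟨d, (embedding p n).injective ?_⟩
  rw [map_pow, show embedding p n d = b * conj p n b from hd, mul_pow, ← map_pow, hb,
    conj_embedding, hγ, map_pow, pow_two]

end Tower

theorem exists_pow_eq_of_sq {F : Type*} [Field F] {p : ℕ} (hodd : Odd p) {γ d : F}
    (h : d ^ p = γ ^ 2) : ∃ c : F, c ^ p = γ := by
  obtain ⟨m, hm⟩ := hodd
  rcases eq_or_ne γ 0 with rfl | hγ
  · exact ⟨0, zero_pow (by lia)⟩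
  -- With `p = 2m + 1`, the `p`-th power of this is `γ^{2m+1} / γ^{2m} = γ`.
  refine ⟨γ / d ^ m, ?_⟩
  rw [div_pow, ← pow_mul, mul_comm, pow_mul, h, ← pow_mul, hm, pow_succ, mul_div_cancel_left₀]
  exact pow_ne_zero _ hγ

end CyclotomicTower

end

theorem mainTheorem10 (p : ℕ) [Fact p.Prime] (hp : Odd p)
    (γ : CyclotomicTower.k p 0) (hreal : CyclotomicTower.conj p 0 γ = γ)
    (hram : CyclotomicTower.RootExtensionRamified p 0 γ) :
    ∀ n : ℕ, CyclotomicTower.RootExtensionRamified p n (CyclotomicTower.embedding p n γ) := by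
  intro n
  by_contra h
  obtain ⟨b, hb⟩ := CyclotomicTower.exists_pow_eq_of_not_rootExtensionRamified p n hp
    ((CyclotomicTower.conj_embedding p n γ).trans (congrArg _ hreal)) h
  obtain ⟨d, hd⟩ := CyclotomicTower.exists_pow_eq_sq p n hreal hb
  obtain ⟨c, rfl⟩ := CyclotomicTower.exists_pow_eq_of_sq hp hd
  exact CyclotomicTower.not_rootExtensionRamified_pow p 0 c hram
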